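/- For $n \ge 0$ let $S_n$ denote the star with one central vertex adjacent to $n$ other vertices, no two of which are adjacent. Let $G \square H$ denote the Cartesian product of graphs: $(u,v)$ and $(u',v')$ are adjacent if and only if either $v=v'$ and $u\sim u'$, or $u=u'$ and $v\sim v'$. Let $G^p$ denote the $p$-th power of $G$, the graph on the vertices of $G$ in which two distinct vertices are adjacent if and only if their distance in $G$ is at most $p$. A $b$-coloring of $G$ with $k$ colors is a proper coloring of $G$ with $k$ colors such that for each color $i$ there is a vertex of color $i$ which, for each color $j \ne i$, has a neighbor of color $j$. The $b$-chromatic number $\varphi(G)$ is the largest $k$ such that $G$ has a $b$-coloring with $k$ colors. Then $$\varphi((S_1\square S_3)^3) = 8,\quad \varphi((S_2\square S_3)^3) = 9,\quad \varphi((S_3\square S_3)^3) = 10,\quad \varphi((S_4\square S_3)^3) = 13,\quad \varphi((S_5\square S_3)^3) = 15,$$ and $\varphi((S_n\square S_3)^3) = 2n+4$ for every integer $n \ge 6$. -/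

import Mathlib

namespace SimpleGraph

/-- The star `S_n`: a central vertex `0`, adjacent to each of `n` other vertices, with no other
edges. -/
def star (n : ℕ) : SimpleGraph (Fin (n + 1)) :=
  starGraph 0

/-- The `p`-th power of a graph: distinct vertices are adjacent when their distance in `G` is at
most `p` (the extended distance is `⊤` between different components). -/
def powerGraph {V : Type*} (G : SimpleGraph V) (p : ℕ) : SimpleGraph V where
  Adj u v := u ≠ v ∧ G.edist u v ≤ p
  symm := ⟨fun _ _ h => ⟨h.1.symm, by rw [edist_comm]; exact h.2⟩⟩
  loopless := ⟨fun _ h => h.1 rfl⟩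

/-- A vertex `v` is a `b`-vertex of a proper coloring if every color other than that of `v`
occurs on a neighbor of `v`. -/
def Coloring.IsBVertex {V α : Type*} {G : SimpleGraph V} (C : G.Coloring α) (v : V) : Prop :=
  ∀ j, j ≠ C v → ∃ u, G.Adj v u ∧ C u = j

/-- A proper coloring is a `b`-coloring if every color has a `b`-vertex of that color. -/
def Coloring.IsBColoring {V α : Type*} {G : SimpleGraph V} (C : G.Coloring α) : Prop :=
  ∀ i, ∃ v, C v = i ∧ C.IsBVertex v

/-- The `b`-chromatic number: the largest `k` such that there is a `b`-coloring with `k` colors.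
On a finite graph such `k` are bounded by the number of vertices, see
`SimpleGraph.bddAbove_bColoring`. -/
noncomputable def bChromaticNumber {V : Type*} (G : SimpleGraph V) : ℕ :=
  sSup {k : ℕ | ∃ C : G.Coloring (Fin k), C.IsBColoring}

theorem bddAbove_bColoring {V : Type*} [Finite V] (G : SimpleGraph V) :
    BddAbove {k : ℕ | ∃ C : G.Coloring (Fin k), C.IsBColoring} := by
  refine ⟨Nat.card V, ?_⟩
  rintro k ⟨C, hC⟩
  have hs : Function.Surjective C := fun i => (hC i).imp fun _ h => h.1
  simpa using Nat.card_le_card_of_surjective C hs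

end SimpleGraph

namespace SimpleGraph

/-! Distances in a star are at most 2, so two vertices of the product are non-adjacent in the cube
only at distance 4, when both coordinates are distinct leaves. The `n + 4` vertices with a central
coordinate are thus adjacent to everything and use up `n + 4` private colors; the rest is the rook
graph on an `n × 3` grid. The theorem reduces to its b-chromatic number: 3, 3, 3, 5, 6 for `n = 1,
..., 5`, and `n` for `n ≥ 6`.

Upper bounds: a rook sees `n + 1` other cells, giving `n + 2` colors; this is never attained for `n
≥ 2` (`card_lt_add_two`), more than `n` colors force at most 6 (`card_le_six`), and four colors for
`n = 3` fall to a finite check. Cyclic and explicit fillings give the lower bounds. -/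

theorem edist_star_le_one_iff {n : ℕ} (u v : Fin (n + 1)) :
    (star n).edist u v ≤ 1 ↔ u = v ∨ u = 0 ∨ v = 0 := by
  rw [edist_le_one_iff_adj_or_eq, star, starGraph_adj]
  tauto

theorem edist_star_of_leaves {n : ℕ} {u v : Fin (n + 1)} (huv : u ≠ v) (hu : u ≠ 0)
    (hv : v ≠ 0) : (star n).edist u v = 2 := by
  refine le_antisymm ?_ ?_
  · calc (star n).edist u v ≤ (star n).edist u 0 + (star n).edist 0 v :=
          SimpleGraph.edist_triangle
      _ ≤ 1 + 1 := add_le_add ((edist_star_le_one_iff _ _).2 (by simp))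
          ((edist_star_le_one_iff _ _).2 (by simp))
      _ = 2 := by norm_num
  · have h : ¬ (star n).edist u v ≤ 1 := by
      rw [edist_star_le_one_iff]; tauto
    have := Order.add_one_le_of_lt (not_le.1 h)
    rwa [one_add_one_eq_two] at this

theorem edist_star_le_two {n : ℕ} (u v : Fin (n + 1)) : (star n).edist u v ≤ 2 := by
  by_cases h : u = v ∨ u = 0 ∨ v = 0
  · exact ((edist_star_le_one_iff _ _).2 h).trans (by norm_num)
  · push Not at h
    exact (edist_star_of_leaves h.1 h.2.1 h.2.2).le

/-- Two vertices of the cube of a product of two stars are non-adjacent when they are equal or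
both pairs of coordinates are pairs of distinct leaves. -/
theorem powerGraph_three_star_boxProd_adj {n m : ℕ} (u v : Fin (n + 1) × Fin (m + 1)) :
    ((star n □ star m).powerGraph 3).Adj u v ↔
      u ≠ v ∧ (u.1 = v.1 ∨ u.1 = 0 ∨ v.1 = 0 ∨ u.2 = v.2 ∨ u.2 = 0 ∨ v.2 = 0) := by
  change u ≠ v ∧ _ ↔ _
  refine and_congr_right fun _ => ?_
  rw [edist_boxProd]
  by_cases h₁ : u.1 = v.1 ∨ u.1 = 0 ∨ v.1 = 0
  · refine iff_of_true ?_ (by tauto)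
    refine (add_le_add ((edist_star_le_one_iff _ _).2 h₁) (edist_star_le_two _ _)).trans ?_
    norm_num
  by_cases h₂ : u.2 = v.2 ∨ u.2 = 0 ∨ v.2 = 0
  · refine iff_of_true ?_ (by tauto)
    refine (add_le_add (edist_star_le_two _ _) ((edist_star_le_one_iff _ _).2 h₂)).trans ?_
    norm_num
  refine iff_of_false ?_ (by tauto)
  push Not at h₁ h₂
  rw [edist_star_of_leaves h₁.1 h₁.2.1 h₁.2.2, edist_star_of_leaves h₂.1 h₂.2.1 h₂.2.2]
  decide

/-! ### Upper bounds for grid colorings -/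

/-- A filling of an `n × 3` grid is a `b`-coloring of the rook graph on the grid: the entries of
each line are distinct, and each color has a cell such that the two lines through it contain all
colors. -/
structure IsGridBColoring {n : ℕ} {α : Type*} (f : Fin n → Fin 3 → α) : Prop where
  row_injective : ∀ j, Function.Injective fun i => f i j
  col_injective : ∀ i, Function.Injective (f i)
  exists_cell : ∀ c, ∃ i j, f i j = c ∧ ∀ d, (∃ i', f i' j = d) ∨ ∃ j', f i j' = d

namespace IsGridBColoring

variable {n : ℕ} {α β : Type*} {f : Fin n → Fin 3 → α}

theorem comp_equiv (hf : IsGridBColoring f) (e : α ≃ β) :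
    IsGridBColoring fun i j => e (f i j) where
  row_injective j := e.injective.comp (hf.row_injective j)
  col_injective i := e.injective.comp (hf.col_injective i)
  exists_cell c := by
    obtain ⟨i, j, h, hd⟩ := hf.exists_cell (e.symm c)
    refine ⟨i, j, by simp [h], fun d => ?_⟩
    simpa [Equiv.eq_symm_apply] using hd (e.symm d)

variable [Fintype α]

theorem card_le_add_two (hf : IsGridBColoring f) : Fintype.card α ≤ n + 2 := by
  classical
  rcases isEmpty_or_nonempty α with h | ⟨⟨c⟩⟩
  · simp
  obtain ⟨i, j, -, hd⟩ := hf.exists_cell c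
  have hsub : (Finset.univ : Finset α) ⊆
      Finset.univ.image (fun i' => f i' j) ∪ (Finset.univ.erase j).image (f i) := by
    intro d _
    rw [Finset.mem_union, Finset.mem_image, Finset.mem_image]
    rcases hd d with ⟨i', h⟩ | ⟨j', h⟩
    · exact Or.inl ⟨i', Finset.mem_univ _, h⟩
    · by_cases hj : j' = j
      · exact Or.inl ⟨i, Finset.mem_univ _, hj ▸ h⟩
      · exact Or.inr ⟨j', by simp [hj], h⟩
  refine (Finset.card_le_card hsub).trans ((Finset.card_union_le _ _).trans ?_)
  refine add_le_add (Finset.card_image_le.trans (by simp)) (Finset.card_image_le.trans ?_)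
  simp

/-- With more colors than columns, a cell witnessing a color is determined by its row and the row
in which its column contains a fixed color missing from its row. -/
theorem card_le_six (hf : IsGridBColoring f) (hn : n < Fintype.card α) :
    Fintype.card α ≤ 6 := by
  classical
  have hm : ∀ j, ∃ m, ∀ i, f i j ≠ m := by
    intro j
    by_contra! h
    have := Fintype.card_le_of_surjective (fun i => f i j) h
    rw [Fintype.card_fin] at this
    omega
  choose m hm using hm
  choose I J hIJ hd using hf.exists_cell
  have hK : ∀ c, ∃ t, f (I c) t = m (J c) := fun c =>
    (hd c (m (J c))).resolve_left fun ⟨i, hi⟩ => hm _ i hi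
  choose K hK using hK
  have hne : ∀ c, J c ≠ K c := fun c h => hm (J c) (I c) (by rw [← hK c, ← h])
  have hinj : Function.Injective
      fun c => (⟨(J c, K c), hne c⟩ : {p : Fin 3 × Fin 3 // p.1 ≠ p.2}) := by
    intro c c' h
    simp only [Subtype.mk.injEq, Prod.mk.injEq] at h
    obtain ⟨h₁, h₂⟩ := h
    -- The missing color `m (J c)` occurs at most once in row `K c`, which fixes the column.
    have h₃ : I c = I c' := hf.row_injective (K c) <| by
      change f (I c) (K c) = f (I c') (K c)
      rw [hK c, h₁, ← hK c', h₂]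
    rw [← hIJ c, ← hIJ c', h₁, h₃]
  exact (Fintype.card_le_of_injective _ hinj).trans (by decide)

/-- With at least `n + 2` colors, no color repeats on the two lines through a witnessing cell. -/
theorem ne_of_forall_exists (hn : n + 2 ≤ Fintype.card α)
    {i : Fin n} {j t : Fin 3} (h : ∀ d, (∃ i', f i' j = d) ∨ ∃ j', f i j' = d) (ht : t ≠ j)
    (i' : Fin n) : f i' j ≠ f i t := by
  classical
  intro he
  obtain ⟨s, hs⟩ : ∃ s : Fin 3, ∀ x, x = j ∨ x = t ∨ x = s := by
    clear h he
    revert j t; decide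
  -- After a repetition, row `j` and the one remaining cell of the column carry all colors, at most
  -- `n + 1`.
  have hsub : (Finset.univ : Finset α) ⊆
      insert (f i s) (Finset.univ.image fun i' => f i' j) := by
    intro d _
    rw [Finset.mem_insert, Finset.mem_image]
    rcases h d with ⟨x, hx⟩ | ⟨x, hx⟩
    · exact Or.inr ⟨x, Finset.mem_univ _, hx⟩
    · rcases hs x with rfl | rfl | rfl
      · exact Or.inr ⟨i, Finset.mem_univ _, hx⟩
      · exact Or.inr ⟨i', Finset.mem_univ _, he.trans hx⟩
      · exact Or.inl hx.symm
  have h₁ := (Finset.card_le_card hsub).trans (Finset.card_insert_le _ _)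
  have h₂ : (Finset.univ.image fun i' => f i' j).card ≤ n := Finset.card_image_le.trans (by simp)
  rw [Finset.card_univ] at h₁
  omega

theorem card_lt_add_two (hf : IsGridBColoring f) (hn : 2 ≤ n) : Fintype.card α < n + 2 := by
  classical
  by_contra! hcard
  choose I J hIJ hd using hf.exists_cell
  -- If two witnesses share a column, each is the only witness in its row: another witness in that
  -- row would have to see the color of the column's third cell, which can occur neither in that row
  -- nor in the row of the other witness, and in the third row only in the shared column.
  have key : ∀ c c' d, c ≠ c' → I c = I c' → J d = J c → d = c := by
    intro c c' d hne hI hJd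
    have hJ : J c ≠ J c' := fun h => hne (by rw [← hIJ c, ← hIJ c', hI, h])
    obtain ⟨t, htj, htj', ht⟩ : ∃ t, t ≠ J c ∧ t ≠ J c' ∧ ∀ x, x = J c ∨ x = J c' ∨ x = t := by
      clear hJd
      generalize J c = j at hJ ⊢
      generalize J c' = j' at hJ ⊢
      revert j j'; decide
    have h₁ := ne_of_forall_exists hcard (hd c) htj
    have h₂ := ne_of_forall_exists hcard (hd c') htj'
    rcases hd d (f (I c) t) with ⟨x, hx⟩ | ⟨x, hx⟩
    · exact absurd hx (hJd ▸ h₁ x)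
    · rcases ht x with rfl | rfl | rfl
      · exact absurd hx (h₁ _)
      · exact absurd hx (hI ▸ h₂ _)
      · rw [← hIJ d, ← hIJ c, hJd, hf.row_injective _ hx]
  obtain ⟨c, c', hne, hI⟩ : ∃ c c', c ≠ c' ∧ I c = I c' :=
    Fintype.exists_ne_map_eq_of_card_lt I (by rw [Fintype.card_fin]; omega)
  have hJ : J c ≠ J c' := fun h => hne (by rw [← hIJ c, ← hIJ c', hI, h])
  -- By `key`, the witnesses of the remaining `n` or more colors all lie in the third row and fill
  -- it. One of them shares the column of `c`, so `key` makes it alone in its row, against `n ≥ 2`.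
  let S : Finset α := (Finset.univ.erase c).erase c'
  have hS : n ≤ S.card := by
    rw [Finset.card_erase_of_mem (by simp [hne.symm]), Finset.card_erase_of_mem (by simp),
      Finset.card_univ]
    omega
  have hJS : ∀ d ∈ S, J d ≠ J c ∧ J d ≠ J c' := by
    intro d hd
    simp only [S, Finset.mem_erase, Finset.mem_univ, and_true] at hd
    exact ⟨fun h => hd.2 (key c c' d hne hI h), fun h => hd.1 (key c' c d hne.symm hI.symm h)⟩
  have hJS' : ∀ d ∈ S, ∀ e ∈ S, J d = J e := by
    intro d hd e he
    have h₁ := hJS d hd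
    have h₂ := hJS e he
    omega
  have hIS : Set.InjOn I S := fun d hd e he h => by
    rw [← hIJ d, ← hIJ e, h, hJS' d hd e he]
  have himg : S.image I = Finset.univ := by
    refine Finset.eq_univ_of_card _ (le_antisymm (Finset.card_le_univ _) ?_)
    rw [Finset.card_image_of_injOn hIS, Fintype.card_fin]
    exact hS
  obtain ⟨d, hdS, hdI⟩ := Finset.mem_image.1 (himg ▸ Finset.mem_univ (I c))
  have hdc : d ≠ c := fun h => (hJS d hdS).1 (by rw [h])
  have hsub : S ⊆ {d} := fun e he =>
    Finset.mem_singleton.2 (key d c e hdc hdI (hJS' e he d hdS))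
  have := Finset.card_le_card hsub
  rw [Finset.card_singleton] at this
  omega

end IsGridBColoring

/-! ### The exceptional case of the `3 × 3` grid -/

set_option synthInstance.maxHeartbeats 400000 in
set_option synthInstance.maxSize 4000 in
set_option maxRecDepth 10000 in
/-- There is no `b`-coloring of the `3 × 3` grid with four colors in which the first row is
`1, 2, 3`. -/
theorem not_forall_exists_cell_three_four : ∀ b₁ : Fin 4, b₁ ≠ 1 →
    ∀ b₂ : Fin 4, b₂ ≠ 2 → b₂ ≠ b₁ → ∀ b₃ : Fin 4, b₃ ≠ 3 → b₃ ≠ b₁ → b₃ ≠ b₂ →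
    ∀ c₁ : Fin 4, c₁ ≠ 1 → c₁ ≠ b₁ → ∀ c₂ : Fin 4, c₂ ≠ 2 → c₂ ≠ b₂ → c₂ ≠ c₁ →
    ∀ c₃ : Fin 4, c₃ ≠ 3 → c₃ ≠ b₃ → c₃ ≠ c₁ → c₃ ≠ c₂ →
    ¬ ∀ c : Fin 4, ∃ i j : Fin 3, ![![1, b₁, c₁], ![2, b₂, c₂], ![3, b₃, c₃]] i j = c ∧
      ∀ d : Fin 4, (∃ i', ![![1, b₁, c₁], ![2, b₂, c₂], ![3, b₃, c₃]] i' j = d) ∨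
        ∃ j', ![![1, b₁, c₁], ![2, b₂, c₂], ![3, b₃, c₃]] i j' = d := by
  decide +kernel

/-- The first row misses exactly one color; renaming that color 0 and the row 1, 2, 3 leaves the
finite check. -/
theorem not_isGridBColoring_three_four (f : Fin 3 → Fin 3 → Fin 4) : ¬ IsGridBColoring f := by
  intro hf
  obtain ⟨d, hd⟩ : ∃ d, d ∉ Set.range fun i => f i 0 := by
    by_contra! h
    simpa using Fintype.card_le_of_surjective (fun i => f i 0) h
  have hσ : Function.Bijective (Fin.cons d fun i => f i 0 : Fin 4 → Fin 4) :=
    Finite.injective_iff_bijective.1 (Fin.cons_injective_iff.2 ⟨hd, hf.row_injective 0⟩)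
  let σ := Equiv.ofBijective _ hσ
  have h0 : ∀ i, σ.symm (f i 0) = i.succ := fun i => by
    rw [Equiv.symm_apply_eq]
    exact (Fin.cons_succ (α := fun _ => Fin 4) d (fun i => f i 0) i).symm
  have hg := hf.comp_equiv σ.symm
  generalize hgdef : (fun i j => σ.symm (f i j)) = g at hg
  have hg0 : ∀ i, g i 0 = i.succ := fun i => by rw [← hgdef, ← h0]
  have hr : ∀ j i i', i ≠ i' → g i j ≠ g i' j := fun j _ _ h => (hg.row_injective j).ne h
  have hc : ∀ i j j', j ≠ j' → g i j ≠ g i j' := fun i _ _ h => (hg.col_injective i).ne h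
  have h₁ : g 0 0 = 1 := hg0 0
  have h₂ : g 1 0 = 2 := hg0 1
  have h₃ : g 2 0 = 3 := hg0 2
  have hgm : g = ![![1, g 0 1, g 0 2], ![2, g 1 1, g 1 2], ![3, g 2 1, g 2 2]] := by
    ext i j
    fin_cases i <;> fin_cases j <;> simp [h₁, h₂, h₃]
  refine not_forall_exists_cell_three_four (g 0 1) ?_ (g 1 1) ?_ ?_ (g 2 1) ?_ ?_ ?_
    (g 0 2) ?_ ?_ (g 1 2) ?_ ?_ ?_ (g 2 2) ?_ ?_ ?_ ?_ (hgm ▸ hg.exists_cell)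
  all_goals first
    | exact hr _ _ _ (by decide)
    | exact hc _ _ _ (by decide)
    | exact h₁ ▸ hc _ _ _ (by decide)
    | exact h₂ ▸ hc _ _ _ (by decide)
    | exact h₃ ▸ hc _ _ _ (by decide)

/-! ### Optimal fillings -/

theorem exists_isGridBColoring_four : ∃ f : Fin 4 → Fin 3 → Fin 5, IsGridBColoring f :=
  ⟨![![4, 0, 1], ![0, 3, 4], ![1, 2, 3], ![3, 4, 2]], by decide, by decide, by decide⟩

theorem exists_isGridBColoring_five : ∃ f : Fin 5 → Fin 3 → Fin 6, IsGridBColoring f :=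
  ⟨![![0, 3, 4], ![1, 0, 5], ![4, 5, 0], ![3, 2, 1], ![5, 4, 2]],
    by decide, by decide, by decide⟩

/-- In a cyclic filling modulo 3 every column already contains all colors, so each of its cells is a
witness. -/
theorem exists_isGridBColoring_three_colors {n : ℕ} (h₁ : 1 ≤ n) (h₃ : n ≤ 3) :
    ∃ f : Fin n → Fin 3 → Fin 3, IsGridBColoring f := by
  refine ⟨fun i j => i.castLE h₃ + j, fun j => ?_, fun i => ?_, fun c => ?_⟩
  · exact (add_left_injective j).comp (Fin.castLE_injective h₃)
  · exact add_right_injective _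
  · exact ⟨⟨0, h₁⟩, c - Fin.castLE h₃ ⟨0, h₁⟩, add_sub_cancel _ _,
      fun d => Or.inr ⟨d - Fin.castLE h₃ ⟨0, h₁⟩, add_sub_cancel _ _⟩⟩

/-- The same cyclic filling modulo `n`, where every row contains all colors. -/
theorem exists_isGridBColoring_of_three_le {n : ℕ} (h₃ : 3 ≤ n) :
    ∃ f : Fin n → Fin 3 → Fin n, IsGridBColoring f := by
  have : NeZero n := ⟨by omega⟩
  refine ⟨fun i j => i + j.castLE h₃, fun j => ?_, fun i => ?_, fun c => ?_⟩
  · exact add_left_injective _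
  · exact (add_right_injective i).comp (Fin.castLE_injective h₃)
  · exact ⟨c - Fin.castLE h₃ 0, 0, sub_add_cancel _ _,
      fun d => Or.inl ⟨d - Fin.castLE h₃ 0, sub_add_cancel _ _⟩⟩

/-! ### Reduction from the cube of the product to the grid -/

/-- The vertices of the product of two stars with a central coordinate. -/
def hubVertex {n : ℕ} : Option (Fin n ⊕ Fin 3) → Fin (n + 1) × Fin (3 + 1)
  | none => (0, 0)
  | some (Sum.inl i) => (i.succ, 0)
  | some (Sum.inr j) => (0, j.succ)

theorem hubVertex_injective {n : ℕ} : Function.Injective (hubVertex (n := n)) := by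
  rintro (_ | _ | _) (_ | _ | _) h <;> simp_all [hubVertex, Fin.succ_ne_zero, eq_comm]

theorem powerGraph_adj_hubVertex {n : ℕ} (x : Option (Fin n ⊕ Fin 3))
    {v : Fin (n + 1) × Fin (3 + 1)} (h : hubVertex x ≠ v) :
    ((star n □ star 3).powerGraph 3).Adj (hubVertex x) v := by
  rw [powerGraph_three_star_boxProd_adj]
  refine ⟨h, ?_⟩
  rcases x with _ | _ | _ <;> simp [hubVertex]

theorem exists_hubVertex_or_succ {n : ℕ} (v : Fin (n + 1) × Fin (3 + 1)) :
    (∃ x, hubVertex x = v) ∨ ∃ i j, v = (Fin.succ i, Fin.succ j) := by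
  obtain ⟨i, j⟩ := v
  refine Fin.cases ?_ (fun i => ?_) i <;> refine Fin.cases ?_ (fun j => ?_) j
  · exact Or.inl ⟨none, rfl⟩
  · exact Or.inl ⟨some (Sum.inr j), rfl⟩
  · exact Or.inl ⟨some (Sum.inl i), rfl⟩
  · exact Or.inr ⟨i, j, rfl⟩

theorem powerGraph_adj_succ_succ {n : ℕ} (i i' : Fin n) (j j' : Fin 3) :
    ((star n □ star 3).powerGraph 3).Adj (i.succ, j.succ) (i'.succ, j'.succ) ↔
      (i ≠ i' ∨ j ≠ j') ∧ (i = i' ∨ j = j') := by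
  rw [powerGraph_three_star_boxProd_adj]
  simp [Fin.succ_ne_zero, imp_iff_not_or]

/-- Hub vertices are universal, so their colors are distinct and occur nowhere else. The other `m`
colors live on the grid, where their b-vertices must also find one another. -/
theorem exists_isGridBColoring_of_isBColoring {n k : ℕ}
    (C : ((star n □ star 3).powerGraph 3).Coloring (Fin k)) (hC : C.IsBColoring) :
    ∃ m, k = n + 4 + m ∧ ∃ f : Fin n → Fin 3 → Fin m, IsGridBColoring f := by
  classical
  let H : Finset (Fin k) := Finset.univ.image fun x => C (hubVertex x)
  have hinj : Function.Injective fun x : Option (Fin n ⊕ Fin 3) => C (hubVertex x) := by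
    intro x y h
    by_contra hxy
    exact C.valid (powerGraph_adj_hubVertex x (hubVertex_injective.ne hxy)) h
  have hH : H.card = n + 4 := by
    rw [Finset.card_image_of_injective _ hinj]
    simp
  have hcompl := H.card_compl_add_card
  rw [hH, Fintype.card_fin] at hcompl
  have hmem : ∀ i j, C (Fin.succ i, Fin.succ j) ∈ Hᶜ := by
    intro i j
    simp only [H, Finset.mem_compl, Finset.mem_image, Finset.mem_univ, true_and, not_exists]
    intro x
    refine C.valid (powerGraph_adj_hubVertex x ?_)
    rcases x with _ | _ | _ <;> simp [hubVertex, Fin.succ_ne_zero, eq_comm]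
  have hleaf : ∀ v, C v ∈ Hᶜ → ∃ i j, v = (Fin.succ i, Fin.succ j) := by
    intro v hv
    refine (exists_hubVertex_or_succ v).resolve_left ?_
    rintro ⟨x, rfl⟩
    simp [H] at hv
  refine ⟨Hᶜ.card, by omega, _, IsGridBColoring.comp_equiv
    (f := fun i j => (⟨C (i.succ, j.succ), hmem i j⟩ : {c // c ∈ Hᶜ})) ⟨?_, ?_, ?_⟩
    Hᶜ.equivFin⟩
  · intro j i i' h
    by_contra hne
    exact C.valid ((powerGraph_adj_succ_succ i i' j j).2 (by simp [hne])) (congrArg Subtype.val h)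
  · intro i j j' h
    by_contra hne
    exact C.valid ((powerGraph_adj_succ_succ i i j j').2 (by simp [hne])) (congrArg Subtype.val h)
  · rintro ⟨c, hc⟩
    obtain ⟨v, rfl, hv⟩ := hC c
    obtain ⟨i, j, rfl⟩ := hleaf v hc
    refine ⟨i, j, rfl, ?_⟩
    rintro ⟨d, hd⟩
    by_cases hdc : d = C (i.succ, j.succ)
    · exact Or.inl ⟨i, Subtype.ext hdc.symm⟩
    obtain ⟨u, hu, rfl⟩ := hv d hdc
    obtain ⟨i', j', rfl⟩ := hleaf u hd
    rcases ((powerGraph_adj_succ_succ _ _ _ _).1 hu).2 with rfl | rfl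
    · exact Or.inr ⟨j', rfl⟩
    · exact Or.inl ⟨i', rfl⟩

/-- Colors the hub vertices with distinct new colors and the other vertices by `f`. -/
def hubExtend {n : ℕ} {α : Type*} (f : Fin n → Fin 3 → α) (v : Fin (n + 1) × Fin (3 + 1)) :
    Option (Fin n ⊕ Fin 3) ⊕ α :=
  Fin.cases (Fin.cases (Sum.inl none) (fun j => Sum.inl (some (Sum.inr j))) v.2)
    (fun i => Fin.cases (Sum.inl (some (Sum.inl i))) (fun j => Sum.inr (f i j)) v.2) v.1

theorem hubExtend_hubVertex {n : ℕ} {α : Type*} (f : Fin n → Fin 3 → α)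
    (x : Option (Fin n ⊕ Fin 3)) : hubExtend f (hubVertex x) = Sum.inl x := by
  rcases x with _ | _ | _ <;> rfl

theorem hubExtend_succ_succ {n : ℕ} {α : Type*} (f : Fin n → Fin 3 → α) (i : Fin n)
    (j : Fin 3) : hubExtend f (i.succ, j.succ) = Sum.inr (f i j) := rfl

/-- Hub vertices see every other color because all colors are used; a witnessing cell sees the hub
colors for free. -/
theorem IsGridBColoring.exists_isBColoring {n m : ℕ} {f : Fin n → Fin 3 → Fin m}
    (hf : IsGridBColoring f) :
    ∃ C : ((star n □ star 3).powerGraph 3).Coloring (Fin (n + 4 + m)), C.IsBColoring := by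
  let e : Option (Fin n ⊕ Fin 3) ⊕ Fin m ≃ Fin (n + 4 + m) :=
    Fintype.equivFinOfCardEq (by simp)
  have hvalid : ∀ u v, ((star n □ star 3).powerGraph 3).Adj u v →
      hubExtend f u ≠ hubExtend f v := by
    intro u v huv h
    rcases exists_hubVertex_or_succ u with ⟨x, rfl⟩ | ⟨i, j, rfl⟩ <;>
      rcases exists_hubVertex_or_succ v with ⟨y, rfl⟩ | ⟨i', j', rfl⟩ <;>
      simp only [hubExtend_hubVertex, hubExtend_succ_succ, Sum.inl.injEq, Sum.inr.injEq,
        reduceCtorEq] at h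
    · exact huv.ne (by rw [h])
    · obtain ⟨hne, rfl | rfl⟩ := (powerGraph_adj_succ_succ _ _ _ _).1 huv
      · exact hne.elim (fun h => h rfl) fun hj => hj (hf.col_injective _ h)
      · exact hne.elim (fun hi => hi (hf.row_injective _ h)) fun h => h rfl
  have hsurj : ∀ c, ∃ v, hubExtend f v = c := by
    rintro (x | c)
    · exact ⟨_, hubExtend_hubVertex f x⟩
    · obtain ⟨i, j, rfl, -⟩ := hf.exists_cell c
      exact ⟨_, hubExtend_succ_succ f i j⟩
  refine ⟨Coloring.mk (fun v => e (hubExtend f v)) fun {u v} h =>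
    e.injective.ne (hvalid u v h), fun c => ?_⟩
  obtain ⟨c, rfl⟩ := e.surjective c
  rcases c with x | c
  · refine ⟨hubVertex x, congrArg e (hubExtend_hubVertex f x), fun d hd => ?_⟩
    obtain ⟨d, rfl⟩ := e.surjective d
    obtain ⟨v, rfl⟩ := hsurj d
    refine ⟨v, powerGraph_adj_hubVertex x ?_, rfl⟩
    rintro rfl
    exact hd rfl
  · obtain ⟨i, j, rfl, hcell⟩ := hf.exists_cell c
    refine ⟨(i.succ, j.succ), congrArg e (hubExtend_succ_succ f i j), fun d hd => ?_⟩
    obtain ⟨d, rfl⟩ := e.surjective d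
    rcases d with y | d
    · refine ⟨hubVertex y, (powerGraph_adj_hubVertex y ?_).symm,
        congrArg e (hubExtend_hubVertex f y)⟩
      intro h
      have := hubExtend_hubVertex f y
      rw [h, hubExtend_succ_succ] at this
      cases this
    · rcases hcell d with ⟨i', rfl⟩ | ⟨j', rfl⟩
      · refine ⟨(i'.succ, j.succ), (powerGraph_adj_succ_succ _ _ _ _).2 ⟨Or.inl ?_, Or.inr rfl⟩,
          rfl⟩
        rintro rfl
        exact hd rfl
      · refine ⟨(i.succ, j'.succ), (powerGraph_adj_succ_succ _ _ _ _).2 ⟨Or.inr ?_, Or.inl rfl⟩,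
          rfl⟩
        rintro rfl
        exact hd rfl

theorem bChromaticNumber_powerGraph_star_boxProd {n m : ℕ}
    (hex : ∃ f : Fin n → Fin 3 → Fin m, IsGridBColoring f)
    (hle : ∀ (m' : ℕ) (f : Fin n → Fin 3 → Fin m'), IsGridBColoring f → m' ≤ m) :
    ((star n □ star 3).powerGraph 3).bChromaticNumber = n + 4 + m := by
  obtain ⟨f, hf⟩ := hex
  refine IsGreatest.csSup_eq ⟨hf.exists_isBColoring, ?_⟩
  rintro k ⟨C, hC⟩
  obtain ⟨m', rfl, g, hg⟩ := exists_isGridBColoring_of_isBColoring C hC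
  exact Nat.add_le_add_left (hle m' g hg) _

end SimpleGraph

open SimpleGraph in
theorem theorem4p3 :
    ((star 1 □ star 3).powerGraph 3).bChromaticNumber = 8 ∧
    ((star 2 □ star 3).powerGraph 3).bChromaticNumber = 9 ∧
    ((star 3 □ star 3).powerGraph 3).bChromaticNumber = 10 ∧
    ((star 4 □ star 3).powerGraph 3).bChromaticNumber = 13 ∧
    ((star 5 □ star 3).powerGraph 3).bChromaticNumber = 15 ∧
    ∀ n : ℕ, 6 ≤ n → ((star n □ star 3).powerGraph 3).bChromaticNumber = 2 * n + 4 := by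
  refine ⟨?_, ?_, ?_, ?_, ?_, fun n hn => ?_⟩
  · refine bChromaticNumber_powerGraph_star_boxProd
      (exists_isGridBColoring_three_colors le_rfl (by norm_num)) fun m f hf => ?_
    simpa using hf.card_le_add_two
  · refine bChromaticNumber_powerGraph_star_boxProd
      (exists_isGridBColoring_three_colors (by norm_num) (by norm_num)) fun m f hf => ?_
    have := hf.card_lt_add_two le_rfl
    rw [Fintype.card_fin] at this
    omega
  · refine bChromaticNumber_powerGraph_star_boxProd
      (exists_isGridBColoring_of_three_le le_rfl) fun m f hf => ?_
    have := hf.card_lt_add_two (by norm_num)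
    rw [Fintype.card_fin] at this
    have h₄ : m ≠ 4 := by
      rintro rfl
      exact not_isGridBColoring_three_four f hf
    omega
  · refine bChromaticNumber_powerGraph_star_boxProd exists_isGridBColoring_four fun m f hf => ?_
    have := hf.card_lt_add_two (by norm_num)
    rw [Fintype.card_fin] at this
    omega
  · refine bChromaticNumber_powerGraph_star_boxProd exists_isGridBColoring_five fun m f hf => ?_
    have := hf.card_lt_add_two (by norm_num)
    rw [Fintype.card_fin] at this
    omega
  · rw [bChromaticNumber_powerGraph_star_boxProd (m := n)
      (exists_isGridBColoring_of_three_le (by omega)) fun m f hf => ?_]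
    · omega
    -- More than `n` colors would give `n < m ≤ 6 ≤ n`.
    · by_contra! h
      have := hf.card_le_six (by rwa [Fintype.card_fin])
      rw [Fintype.card_fin] at this
      omega
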